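/- **Proposition 2.** Let $\rho$ be a density matrix of one qubit, diagonalized by a unitary $U_\rho$: $U_\rho\,\rho\,U_\rho^\dagger=(1-p)|0\rangle\langle 0|+p|1\rangle\langle 1|$ with $p\in[0,1]$. Let $H=-\operatorname{Tr}(\rho\log_2\rho)=h(p)$ be its entropy in bits, let $\delta>0$, and for $\nu\in\mathbb N$ put $N=2^\nu$ and $K=\max\{0,\lfloor(1-H-\delta)N\rfloor\}$. *Polar code.* Let $G_1=(1)$, $G_2=\begin{pmatrix}1&0\\1&1\end{pmatrix}$ and $G_N=(I_{N/2}\otimes G_2)R_N(I_2\otimes G_{N/2})$ over $\mathbb F_2$, where $R_N$ is the permutation matrix with $(s_1,\dots,s_N)R_N=(s_1,s_3,\dots,s_{N-1},s_2,s_4,\dots,s_N)$. Let $W$ be the binary symmetric channel with error probability $p$; the $i$-th effective channel has input $u_i$, output $(y,u_1^{i-1})$ and transition probabilities $$W_N^{(i)}(y,u_1^{i-1}\mid u_i)=2^{-(N-1)}\sum_{u_{i+1}^N}\prod_{j=1}^N W\big(y_j\mid (uG_N)_j\big).$$ Let the information set $\mathcal I\subseteq\{1,\dots,N\}$ consist of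 $K$ indices whose effective channels have the largest capacity (mutual information between a uniform input and the output), with ties broken arbitrarily. The $N-K$ indices in $\mathcal I^c$ are frozen. *Syndrome decoder.* Let $X\in\mathbb F_2^N$ have independent bits that equal $1$ with probability $p$, and let $U$ be given by $UG_N=X$. The polar syndrome (successive cancellation) decoder $f:\mathbb F_2^{\mathcal I^c}\to\mathbb F_2^N$ maps a syndrome $s$ to $f(s)=\hat uG_N$, where for $i=1,\dots,N$ in turn $\hat u_i=s_i$ if $i\in\mathcal I^c$, and if $i\in\mathcal I$, then $\hat u_i$ is a value $b$ that maximizes $\Pr(U_1^{i-1}=\hat u_1^{i-1},\,U_i=b)$, with ties broken arbitrarily. Let $T$ be the range of $f$ (the correctable error patterns) and $\Pi^N_K=\sum_{x\in T}|x\rangle\langle x|$. *Claim.* The failure probability of the compression protocol, $$P_\nu=1-\operatorname{Tr}\big(\Pi^N_K\,\bar\rho\big),\qquad \bar\rho=U_\rho^{\otimes N}\rho^{\otimes N}\big(U_\rho^{\otimes N}\big)^\dagger,$$ satisfies $\lim_{\nu\to\infty}P_\nu=0$. The protocol sends the $N-K\le\lceil N(H+\delta)\rceil$ frozen qubits, and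 the number of qubits sent per source qubit, $(N-K)/N$, converges to $\min\{H+\delta,1\}$ as $\nu\to\infty$; as $\delta>0$ is arbitrary, the rate can be brought arbitrarily close to the Schumacher limit $H$. -/

import Mathlib

open scoped Kronecker ComplexOrder

/-! ### Qubit sources

The computational basis of a qubit is indexed by `ZMod 2`, and that of `N` qubits by
`Fin N → ZMod 2`. -/

/-- A density matrix of a single qubit: positive semidefinite of trace one. -/
structure IsDensityMatrix (ρ : Matrix (ZMod 2) (ZMod 2) ℂ) : Prop where
  posSemidef : ρ.PosSemidef
  trace_eq_one : ρ.trace = 1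

/-- The von Neumann entropy `-Tr (ρ log₂ ρ) = -∑ λ log₂ λ` in bits, the sum being over the
eigenvalues of `ρ` with multiplicity (with `0 log 0 = 0`). -/
noncomputable def vonNeumannEntropy {ρ : Matrix (ZMod 2) (ZMod 2) ℂ} (hρ : ρ.IsHermitian) : ℝ :=
  -∑ i, hρ.eigenvalues i * Real.logb 2 (hρ.eigenvalues i)

/-- The `N`-fold tensor power `M^{⊗N}` of a one-qubit operator, in the computational basis. -/
def tensorPower (M : Matrix (ZMod 2) (ZMod 2) ℂ) (N : ℕ) :
    Matrix (Fin N → ZMod 2) (Fin N → ZMod 2) ℂ :=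
  Matrix.of fun x y => ∏ j, M (x j) (y j)

/-- The probability vector of a bit that equals `1` with probability `p`. -/
def bitMass (p : ℝ) (b : ZMod 2) : ℝ := if b = 0 then 1 - p else p

/-- `(1 - p) |0⟩⟨0| + p |1⟩⟨1|`. -/
def diagonalQubit (p : ℝ) : Matrix (ZMod 2) (ZMod 2) ℂ :=
  Matrix.diagonal fun b => (bitMass p b : ℂ)

/-! ### The polar transform -/

/-- The kernel `G₂ = [1 0; 1 1]`. -/
def polarKernel : Matrix (Fin 2) (Fin 2) (ZMod 2) := !![1, 0; 1, 1]

/-- The reverse shuffle: position `2k + b` goes to position `b * (N / 2) + k`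
(with positions counted from `0`, `b ∈ {0, 1}` and `N = 2 M`). -/
def reverseShuffle (M : ℕ) : Fin (M * 2) ≃ Fin (2 * M) :=
  finProdFinEquiv.symm.trans ((Equiv.prodComm (Fin M) (Fin 2)).trans finProdFinEquiv)

/-- The permutation matrix of the reverse shuffle, acting on row vectors by
`(s₁, …, s_N) ↦ (s₁, s₃, …, s_{N-1}, s₂, s₄, …, s_N)`. -/
def reverseShuffleMatrix (M : ℕ) : Matrix (Fin (M * 2)) (Fin (2 * M)) (ZMod 2) :=
  Matrix.of fun i j => if reverseShuffle M i = j then 1 else 0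

/-- The polar transform `G_N`, `N = 2 ^ ν`, given by `G₁ = 1` and
`G_N = (I_{N/2} ⊗ G₂) R_N (I₂ ⊗ G_{N/2})`. It acts on row vectors, `u ↦ u G_N`. -/
def polarTransform : (ν : ℕ) → Matrix (Fin (2 ^ ν)) (Fin (2 ^ ν)) (ZMod 2)
  | 0 => 1
  | ν + 1 =>
    (((1 : Matrix (Fin (2 ^ ν)) (Fin (2 ^ ν)) (ZMod 2)) ⊗ₖ polarKernel).reindex
          finProdFinEquiv finProdFinEquiv
        * reverseShuffleMatrix (2 ^ ν)
        * ((1 : Matrix (Fin 2) (Fin 2) (ZMod 2)) ⊗ₖ polarTransform ν).reindex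
          finProdFinEquiv finProdFinEquiv).reindex
      (finCongr (pow_succ 2 ν).symm) (finCongr (pow_succ' 2 ν).symm)

/-! ### Design of a polar code for the binary symmetric channel -/

/-- Transition probability `W(y | x)` of the binary symmetric channel with error probability `p`. -/
def bsc (p : ℝ) (x y : ZMod 2) : ℝ := bitMass p (y - x)

/-- The `i`-th effective channel of the polar transform over the binary symmetric channel. Its
input is the bit `u_i`, its output is `(y, u₁^{i-1})`, and the other input bits are uniform:
`W_N^{(i)}(y, v | b) = 2^{-(N-1)} ∑ W^N(y | u G_N)`, over all `u` with `u₁^{i-1} = v`, `u_i = b`. -/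
noncomputable def effectiveChannel (p : ℝ) {ν : ℕ} (i : Fin (2 ^ ν)) (b : ZMod 2)
    (o : (Fin (2 ^ ν) → ZMod 2) × ({j : Fin (2 ^ ν) // j < i} → ZMod 2)) : ℝ :=
  (1 / 2 : ℝ) ^ (2 ^ ν - 1) *
    ∑ u : Fin (2 ^ ν) → ZMod 2 with (∀ j, u j.1 = o.2 j) ∧ u i = b,
      ∏ j, bsc p (Matrix.vecMul u (polarTransform ν) j) (o.1 j)

/-- The (symmetric) capacity in bits of a binary-input channel `W(y | b) = W b y`: the mutual
information between a uniform input and the output. -/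
noncomputable def capacity {Y : Type*} [Fintype Y] (W : ZMod 2 → Y → ℝ) : ℝ :=
  ∑ y, ∑ b, 1 / 2 * W b y * Real.logb 2 (W b y / (1 / 2 * W 0 y + 1 / 2 * W 1 y))

/-- `A` is an information set of size `K` for a polar code of length `2 ^ ν` designed for the binary
symmetric channel with error probability `p`: it consists of `K` effective channels of largest
capacity (ties being broken arbitrarily). The remaining indices are frozen. -/
def IsPolarInformationSet (p : ℝ) (ν K : ℕ) (A : Finset (Fin (2 ^ ν))) : Prop :=
  A.card = K ∧ ∀ i ∈ A, ∀ j ∉ A, capacity (effectiveChannel p j) ≤ capacity (effectiveChannel p i)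

/-! ### The polar syndrome decoder -/

/-- The probability that `U₁^{i-1} = u₁^{i-1}` and `U_i = b`, where `U G_N = X` and the bits of `X`
are independent and equal to `1` with probability `p`. -/
def prefixMass (p : ℝ) {ν : ℕ} (u : Fin (2 ^ ν) → ZMod 2) (i : Fin (2 ^ ν)) (b : ZMod 2) : ℝ :=
  ∑ w : Fin (2 ^ ν) → ZMod 2 with (∀ j < i, w j = u j) ∧ w i = b,
    ∏ j, bitMass p (Matrix.vecMul w (polarTransform ν) j)

/-- `f` is a polar syndrome decoder, i.e. a successive cancellation decoder that maps a syndrome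
(the values of the frozen bits, those with index outside `A`) to an error pattern. It determines
`u₁, u₂, …` one after another: a frozen bit is read from the syndrome, and an information bit is set
to a value that is most likely given the bits before it (with any way of breaking ties). The
error pattern is then `u G_N`. -/
def IsPolarSyndromeDecoder (p : ℝ) {ν : ℕ} (A : Finset (Fin (2 ^ ν)))
    (f : ({j : Fin (2 ^ ν) // j ∉ A} → ZMod 2) → (Fin (2 ^ ν) → ZMod 2)) : Prop :=
  ∀ s, ∃ u : Fin (2 ^ ν) → ZMod 2,
    (∀ j : {j : Fin (2 ^ ν) // j ∉ A}, u j.1 = s j) ∧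
    (∀ i ∈ A, ∀ b, prefixMass p u i b ≤ prefixMass p u i (u i)) ∧
    f s = Matrix.vecMul u (polarTransform ν)

/-! ### The compression protocol -/

/-- The projector `∑_{x ∈ T} |x⟩⟨x|`, where `T` is the range of `f`. -/
def correctableProjector {ν : ℕ} {A : Finset (Fin (2 ^ ν))}
    (f : ({j : Fin (2 ^ ν) // j ∉ A} → ZMod 2) → (Fin (2 ^ ν) → ZMod 2)) :
    Matrix (Fin (2 ^ ν) → ZMod 2) (Fin (2 ^ ν) → ZMod 2) ℂ :=
  ∑ x ∈ Finset.univ.image f, Matrix.single x x 1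

/-- The failure probability `1 - Tr (Π ρ̄)` of the protocol, where `Π` projects onto the correctable
error patterns and `ρ̄ = U^{⊗N} ρ^{⊗N} (U^{⊗N})†` is the source state after the change of basis. -/
def failureProbability (ρ U : Matrix (ZMod 2) (ZMod 2) ℂ) {ν : ℕ} {A : Finset (Fin (2 ^ ν))}
    (f : ({j : Fin (2 ^ ν) // j ∉ A} → ZMod 2) → (Fin (2 ^ ν) → ZMod 2)) : ℂ :=
  1 - (correctableProjector f *
    (tensorPower U (2 ^ ν) * tensorPower ρ (2 ^ ν) * (tensorPower U (2 ^ ν)).conjTranspose)).trace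

/-!
Write `X = U G_N`. One level of the recursion for `G_N` turns two independent copies of a bit `b`
with side information `y` into the bit `b₁ + b₂` with side information `(y₁, y₂)` and the bit `b₂`
with side information `(y₁, y₂, b₁ + b₂)`. The chain rule preserves the sum of the two conditional
entropies, while the Bhattacharyya parameter `Z` goes to at most `2 Z - Z ^ 2` and to `Z ^ 2`.
On average `√Z` decreases strictly unless `Z` is close to `0` or `1`, so most parameters polarize.
Since the mean entropy stays `H` and `Z` close to `1` forces an entropy close to one bit, at most
a fraction of about `H` of the parameters is not close to `0`. From such small parameters on,
`Z ^ (1/4)` contracts on average by the factor `3/4` per level, so that `Z = o(1/N)` off a fraction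
`H + δ` of the indices.

The capacity of an effective channel is one minus the conditional entropy of its bit, so every
information bit has an entropy `o(1/N)`. An error pattern can be uncorrectable only if, for some
information bit, its true value given the previous bits is not strictly more likely than its
complement; each of these events has probability at most twice the conditional entropy, and the
union bound over the `N` indices concludes.
-/

/-! ### Binary entropy -/

section BinaryEntropy

open Real

theorem mul_log_add_one_sub_le_negMulLog {c x : ℝ} (hc : 0 < c) (hx : 0 ≤ x) :
    x * (log c + 1 - c * x) ≤ negMulLog x := by
  rcases hx.eq_or_lt with rfl | hx
  · simp
  have h := log_le_sub_one_of_pos (mul_pos hc hx)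
  rw [log_mul hc.ne' hx.ne'] at h
  rw [negMulLog, neg_mul, ← mul_neg]
  exact mul_le_mul_of_nonneg_left (by linarith) hx.le

theorem log_add_one_sub_le_binEntropy {c p : ℝ} (hc : 0 < c) (h0 : 0 ≤ p) (h1 : p ≤ 1) :
    log c + 1 - c + 2 * c * (p * (1 - p)) ≤ binEntropy p := by
  rw [binEntropy_eq_negMulLog_add_negMulLog_one_sub]
  linarith [mul_log_add_one_sub_le_negMulLog hc h0,
    mul_log_add_one_sub_le_negMulLog hc (sub_nonneg.2 h1)]

theorem min_le_binEntropy {p : ℝ} (h0 : 0 ≤ p) (h1 : p ≤ 1) : min p (1 - p) ≤ binEntropy p := by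
  have h := log_add_one_sub_le_binEntropy one_pos h0 h1
  rw [log_one] at h
  rcases le_total p (1 - p) with hp | hp
  · rw [min_eq_left hp]
    nlinarith
  · rw [min_eq_right hp]
    nlinarith

theorem log_two_sub_le_binEntropy {p : ℝ} (h0 : 0 ≤ p) (h1 : p ≤ 1) :
    log 2 - 2 * (1 - 2 * √(p * (1 - p))) ≤ binEntropy p := by
  have h := log_add_one_sub_le_binEntropy two_pos h0 h1
  have hsq := sq_sqrt (mul_nonneg h0 (sub_nonneg.2 h1))
  nlinarith [sq_nonneg (2 * √(p * (1 - p)) - 1)]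

theorem log_one_add_sq_le {r : ℝ} (hr : 0 ≤ r) : log (1 + r ^ 2) ≤ 2 * r := by
  rw [log_le_iff_le_exp (by positivity), two_mul, exp_add]
  nlinarith [add_one_le_exp r]

theorem negMulLog_le_two_mul_sqrt {x : ℝ} (h0 : 0 ≤ x) (h1 : x ≤ 1) :
    negMulLog x ≤ 2 * √(x * (1 - x)) := by
  rcases h0.eq_or_lt with rfl | h0
  · simp
  set w := √(x * (1 - x))
  have hw : w ^ 2 = x * (1 - x) := sq_sqrt (mul_nonneg h0.le (sub_nonneg.2 h1))
  have hinv : 1 + (w / x) ^ 2 = x⁻¹ := by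
    rw [div_pow, hw]
    field_simp
    ring
  calc negMulLog x = x * log (1 + (w / x) ^ 2) := by rw [hinv, log_inv, negMulLog]; ring
    _ ≤ x * (2 * (w / x)) := by gcongr; exact log_one_add_sq_le (by positivity)
    _ = 2 * w := by field_simp

theorem binEntropy_le_four_mul_sqrt {p : ℝ} (h0 : 0 ≤ p) (h1 : p ≤ 1) :
    binEntropy p ≤ 4 * √(p * (1 - p)) := by
  have hp := negMulLog_le_two_mul_sqrt h0 h1
  have hq := negMulLog_le_two_mul_sqrt (sub_nonneg.2 h1) (by linarith)
  rw [sub_sub_cancel, mul_comm (1 - p)] at hq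
  rw [binEntropy_eq_negMulLog_add_negMulLog_one_sub]
  linarith

/-- The unnormalized binary entropy in nats: the contribution to a conditional entropy of a value
of the side information that occurs jointly with the two values of the bit with masses `a`, `b`. -/
noncomputable def bitEntropy (a b : ℝ) : ℝ := negMulLog a + negMulLog b - negMulLog (a + b)

theorem bitEntropy_comm (a b : ℝ) : bitEntropy a b = bitEntropy b a := by
  simp only [bitEntropy, add_comm]

theorem bitEntropy_mul (c a b : ℝ) : bitEntropy (c * a) (c * b) = c * bitEntropy a b := by
  simp only [bitEntropy, ← mul_add, negMulLog_mul]
  ring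

theorem bitEntropy_self_one_sub (p : ℝ) : bitEntropy p (1 - p) = binEntropy p := by
  simp [bitEntropy, binEntropy_eq_negMulLog_add_negMulLog_one_sub]

theorem bitEntropy_mul_add_bitEntropy_mul (a b c d : ℝ) :
    bitEntropy (a * c + b * d) (b * c + a * d) +
        (bitEntropy (a * c) (b * d) + bitEntropy (b * c) (a * d)) =
      (c + d) * bitEntropy a b + (a + b) * bitEntropy c d := by
  have h : a * c + b * d + (b * c + a * d) = (a + b) * (c + d) := by ring
  simp only [bitEntropy, h, negMulLog_mul]
  ring

theorem exists_eq_mul_one_sub {a b : ℝ} (ha : 0 ≤ a) (hb : 0 ≤ b) :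
    ∃ s p, 0 ≤ s ∧ 0 ≤ p ∧ p ≤ 1 ∧ a = s * p ∧ b = s * (1 - p) := by
  rcases (add_nonneg ha hb).eq_or_lt with h | h
  · exact ⟨0, 0, le_rfl, le_rfl, zero_le_one, by linarith, by linarith⟩
  · refine ⟨a + b, a / (a + b), h.le, by positivity, div_le_one_of_le₀ (by linarith) h.le, ?_, ?_⟩
    · field_simp
    · field_simp
      ring

theorem sqrt_mul_mul_mul_left {s : ℝ} (hs : 0 ≤ s) (a b : ℝ) :
    √(s * a * (s * b)) = s * √(a * b) := by
  rw [mul_mul_mul_comm, sqrt_mul (mul_self_nonneg s), sqrt_mul_self hs]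

theorem bitEntropy_nonneg {a b : ℝ} (ha : 0 ≤ a) (hb : 0 ≤ b) : 0 ≤ bitEntropy a b := by
  obtain ⟨s, p, hs, h0, h1, rfl, rfl⟩ := exists_eq_mul_one_sub ha hb
  rw [bitEntropy_mul, bitEntropy_self_one_sub]
  exact mul_nonneg hs (binEntropy_nonneg h0 h1)

theorem min_le_bitEntropy {a b : ℝ} (ha : 0 ≤ a) (hb : 0 ≤ b) : min a b ≤ bitEntropy a b := by
  obtain ⟨s, p, hs, h0, h1, rfl, rfl⟩ := exists_eq_mul_one_sub ha hb
  rw [bitEntropy_mul, bitEntropy_self_one_sub, ← mul_min_of_nonneg _ _ hs]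
  exact mul_le_mul_of_nonneg_left (min_le_binEntropy h0 h1) hs

theorem log_two_mul_sub_le_bitEntropy {a b : ℝ} (ha : 0 ≤ a) (hb : 0 ≤ b) :
    log 2 * (a + b) - 2 * (a + b - 2 * √(a * b)) ≤ bitEntropy a b := by
  obtain ⟨s, p, hs, h0, h1, rfl, rfl⟩ := exists_eq_mul_one_sub ha hb
  rw [bitEntropy_mul, bitEntropy_self_one_sub, sqrt_mul_mul_mul_left hs]
  have h := mul_le_mul_of_nonneg_left (log_two_sub_le_binEntropy h0 h1) hs
  linarith

theorem bitEntropy_le_four_mul_sqrt {a b : ℝ} (ha : 0 ≤ a) (hb : 0 ≤ b) :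
    bitEntropy a b ≤ 4 * √(a * b) := by
  obtain ⟨s, p, hs, h0, h1, rfl, rfl⟩ := exists_eq_mul_one_sub ha hb
  rw [bitEntropy_mul, bitEntropy_self_one_sub, sqrt_mul_mul_mul_left hs]
  have h := mul_le_mul_of_nonneg_left (binEntropy_le_four_mul_sqrt h0 h1) hs
  linarith

end BinaryEntropy

/-! ### Binary sources with side information -/

section Source

open Real

theorem sum_zmod_two {M : Type*} [AddCommMonoid M] (g : ZMod 2 → M) : ∑ b, g b = g 0 + g 1 :=
  Fin.sum_univ_two g

variable {Y : Type*} [Fintype Y]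

/-- The sum of `F (P y 0) (P y 1)` over the values `y` of the side information of a source. Here and
below a source is given by the masses `P y b` with which the side information is `y` and the bit
is `b`. -/
def sourceSum (F : ℝ → ℝ → ℝ) (P : Y → ZMod 2 → ℝ) : ℝ := ∑ y, F (P y 0) (P y 1)

/-- The conditional entropy, in nats, of the bit given the side information. -/
noncomputable def condEntropy (P : Y → ZMod 2 → ℝ) : ℝ := sourceSum bitEntropy P

/-- The Bhattacharyya parameter of a source. It is close to `0` when the side information
determines the bit, and close to `1` when the bit is nearly uniform given it. -/
noncomputable def bhattacharyya (P : Y → ZMod 2 → ℝ) : ℝ := sourceSum (fun a b => 2 * √(a * b)) P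

/-- A family of masses is a source if it is a probability distribution on `Y × ZMod 2`. -/
structure IsSource (P : Y → ZMod 2 → ℝ) : Prop where
  nonneg : ∀ y b, 0 ≤ P y b
  total : sourceSum (· + ·) P = 1

/-- The easier half of a polarization step: of two independent copies `(y, b₁)` and `(z, b₂)` of
the source, the bit is `b₂` and the side information is `((y, z), b₁ + b₂)`. -/
def plusSource (P : Y → ZMod 2 → ℝ) (o : (Y × Y) × ZMod 2) (b : ZMod 2) : ℝ :=
  P o.1.1 (o.2 + b) * P o.1.2 b

/-- The harder half of a polarization step: of two independent copies `(y, b₁)` and `(z, b₂)` of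
the source, the bit is `b₁ + b₂` and the side information is `(y, z)`. -/
def minusSource (P : Y → ZMod 2 → ℝ) (o : Y × Y) (s : ZMod 2) : ℝ := ∑ b, plusSource P (o, s) b

theorem sourceSum_plusSource (F : ℝ → ℝ → ℝ) (P : Y → ZMod 2 → ℝ) :
    sourceSum F (plusSource P) = ∑ y, ∑ z,
      (F (P y 0 * P z 0) (P y 1 * P z 1) + F (P y 1 * P z 0) (P y 0 * P z 1)) := by
  simp only [sourceSum, plusSource, Fintype.sum_prod_type, sum_zmod_two, zero_add, add_zero,
    CharTwo.add_self_eq_zero]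

theorem sourceSum_minusSource (F : ℝ → ℝ → ℝ) (P : Y → ZMod 2 → ℝ) :
    sourceSum F (minusSource P) = ∑ y, ∑ z,
      F (P y 0 * P z 0 + P y 1 * P z 1) (P y 1 * P z 0 + P y 0 * P z 1) := by
  simp only [sourceSum, minusSource, plusSource, Fintype.sum_prod_type, sum_zmod_two, zero_add,
    add_zero, CharTwo.add_self_eq_zero]

theorem sourceSum_mul_sourceSum (F G : ℝ → ℝ → ℝ) (P : Y → ZMod 2 → ℝ) :
    sourceSum F P * sourceSum G P = ∑ y, ∑ z, F (P y 0) (P y 1) * G (P z 0) (P z 1) :=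
  Fintype.sum_mul_sum _ _

theorem bhattacharyya_nonneg (P : Y → ZMod 2 → ℝ) : 0 ≤ bhattacharyya P :=
  Finset.sum_nonneg fun _ _ => by positivity

theorem sqrt_mul_mul_mul_comm {a b c d : ℝ} (ha : 0 ≤ a) (hb : 0 ≤ b) :
    √(a * c * (b * d)) = √(a * b) * √(c * d) := by
  rw [mul_mul_mul_comm, sqrt_mul (mul_nonneg ha hb)]

theorem sqrt_mix_le {a b c d : ℝ} (ha : 0 ≤ a) (hb : 0 ≤ b) (hc : 0 ≤ c) (hd : 0 ≤ d)
    (hab : 2 * √(a * b) ≤ a + b) (hcd : 2 * √(c * d) ≤ c + d) :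
    √((a * c + b * d) * (b * c + a * d)) ≤
      √(a * b) * (c + d) + √(c * d) * (a + b) - 2 * (√(a * b) * √(c * d)) := by
  have hu2 := sq_sqrt (mul_nonneg ha hb)
  have hv2 := sq_sqrt (mul_nonneg hc hd)
  have hu := sqrt_nonneg (a * b)
  have hv := sqrt_nonneg (c * d)
  set u := √(a * b)
  set v := √(c * d)
  refine sqrt_le_iff.2 ⟨by nlinarith, ?_⟩
  have hexpand : (a * c + b * d) * (b * c + a * d) =
      u ^ 2 * ((c + d) ^ 2 - 2 * v ^ 2) + v ^ 2 * ((a + b) ^ 2 - 2 * u ^ 2) := by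
    rw [hu2, hv2]
    ring
  have hcross : 0 ≤ 2 * (u * v) * ((a + b - 2 * u) * (c + d - 2 * v)) :=
    mul_nonneg (by positivity) (mul_nonneg (sub_nonneg.2 hab) (sub_nonneg.2 hcd))
  rw [hexpand]
  linarith

namespace IsSource

variable {P : Y → ZMod 2 → ℝ}

theorem condEntropy_nonneg (hP : IsSource P) : 0 ≤ condEntropy P :=
  Finset.sum_nonneg fun y _ => bitEntropy_nonneg (hP.nonneg y 0) (hP.nonneg y 1)

theorem sourceSum_min_le_condEntropy (hP : IsSource P) : sourceSum min P ≤ condEntropy P :=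
  Finset.sum_le_sum fun y _ => min_le_bitEntropy (hP.nonneg y 0) (hP.nonneg y 1)

theorem condEntropy_le_two_mul_bhattacharyya (hP : IsSource P) :
    condEntropy P ≤ 2 * bhattacharyya P := by
  rw [bhattacharyya, sourceSum, Finset.mul_sum]
  refine Finset.sum_le_sum fun y _ => ?_
  linarith [bitEntropy_le_four_mul_sqrt (hP.nonneg y 0) (hP.nonneg y 1)]

theorem log_two_sub_le_condEntropy (hP : IsSource P) :
    log 2 - 2 * (1 - bhattacharyya P) ≤ condEntropy P := by
  calc log 2 - 2 * (1 - bhattacharyya P)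
      = log 2 * sourceSum (· + ·) P - 2 * (sourceSum (· + ·) P - bhattacharyya P) := by
        rw [hP.total, mul_one]
    _ = ∑ y, (log 2 * (P y 0 + P y 1) - 2 * (P y 0 + P y 1 - 2 * √(P y 0 * P y 1))) := by
        simp only [bhattacharyya, sourceSum, ← Finset.sum_sub_distrib, Finset.mul_sum]
    _ ≤ condEntropy P := Finset.sum_le_sum fun y _ =>
        log_two_mul_sub_le_bitEntropy (hP.nonneg y 0) (hP.nonneg y 1)

theorem two_mul_sqrt_le_add (hP : IsSource P) (y : Y) : 2 * √(P y 0 * P y 1) ≤ P y 0 + P y 1 := by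
  have h := two_mul_le_add_sq √(P y 0) √(P y 1)
  rwa [sq_sqrt (hP.nonneg y 0), sq_sqrt (hP.nonneg y 1), mul_assoc, ← sqrt_mul (hP.nonneg y 0)] at h

theorem bhattacharyya_le_one (hP : IsSource P) : bhattacharyya P ≤ 1 :=
  (Finset.sum_le_sum fun y _ => hP.two_mul_sqrt_le_add y).trans_eq hP.total

theorem bhattacharyya_plusSource (hP : IsSource P) :
    bhattacharyya (plusSource P) = bhattacharyya P ^ 2 := by
  rw [sq, bhattacharyya, bhattacharyya, sourceSum_mul_sourceSum, sourceSum_plusSource]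
  refine Finset.sum_congr rfl fun y _ => Finset.sum_congr rfl fun z _ => ?_
  rw [sqrt_mul_mul_mul_comm (hP.nonneg y 0) (hP.nonneg y 1),
    sqrt_mul_mul_mul_comm (hP.nonneg y 1) (hP.nonneg y 0), mul_comm (P y 1) (P y 0)]
  ring

theorem bhattacharyya_minusSource_le (hP : IsSource P) :
    bhattacharyya (minusSource P) ≤ 2 * bhattacharyya P - bhattacharyya P ^ 2 := by
  calc bhattacharyya (minusSource P)
      ≤ ∑ y, ∑ z, (2 * √(P y 0 * P y 1) * (P z 0 + P z 1) +
          (P y 0 + P y 1) * (2 * √(P z 0 * P z 1)) -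
          2 * √(P y 0 * P y 1) * (2 * √(P z 0 * P z 1))) := by
        rw [bhattacharyya, sourceSum_minusSource]
        gcongr with y _ z _
        linarith [sqrt_mix_le (hP.nonneg y 0) (hP.nonneg y 1) (hP.nonneg z 0) (hP.nonneg z 1)
          (hP.two_mul_sqrt_le_add y) (hP.two_mul_sqrt_le_add z)]
    _ = bhattacharyya P * sourceSum (· + ·) P + sourceSum (· + ·) P * bhattacharyya P -
          bhattacharyya P * bhattacharyya P := by
        simp only [bhattacharyya, sourceSum_mul_sourceSum, Finset.sum_sub_distrib,
          Finset.sum_add_distrib]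
    _ = 2 * bhattacharyya P - bhattacharyya P ^ 2 := by
        rw [hP.total]
        ring

theorem condEntropy_minusSource_add_condEntropy_plusSource (hP : IsSource P) :
    condEntropy (minusSource P) + condEntropy (plusSource P) = 2 * condEntropy P := by
  calc condEntropy (minusSource P) + condEntropy (plusSource P)
      = condEntropy P * sourceSum (· + ·) P + sourceSum (· + ·) P * condEntropy P := by
        simp only [condEntropy, sourceSum_minusSource, sourceSum_plusSource,
          sourceSum_mul_sourceSum, ← Finset.sum_add_distrib, bitEntropy_mul_add_bitEntropy_mul]
        refine Finset.sum_congr rfl fun y _ => Finset.sum_congr rfl fun z _ => ?_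
        ring
    _ = 2 * condEntropy P := by
        rw [hP.total]
        ring

end IsSource

end Source

/-! ### Sources generated by random variables -/

section JointMass

variable {Ω Y : Type*} [Fintype Ω] [DecidableEq Y]

/-- The source with bit `X` and side information `S`, both of them random variables on the finite
set `Ω` with masses `m`. -/
def jointMass (m : Ω → ℝ) (S : Ω → Y) (X : Ω → ZMod 2) (y : Y) (b : ZMod 2) : ℝ :=
  ∑ ω with S ω = y ∧ X ω = b, m ω

variable {m : Ω → ℝ} {S : Ω → Y} {X : Ω → ZMod 2}

theorem jointMass_nonneg (hm : ∀ ω, 0 ≤ m ω) (y : Y) (b : ZMod 2) : 0 ≤ jointMass m S X y b :=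
  Finset.sum_nonneg fun ω _ => hm ω

theorem jointMass_eq_zero {y : Y} (hy : ∀ ω, S ω ≠ y) (b : ZMod 2) : jointMass m S X y b = 0 := by
  simp [jointMass, hy]

theorem jointMass_comp_equiv {Ω' : Type*} [Fintype Ω'] (e : Ω' ≃ Ω) (m : Ω → ℝ) (S : Ω → Y)
    (X : Ω → ZMod 2) : jointMass (m ∘ e) (S ∘ e) (X ∘ e) = jointMass m S X := by
  funext y b
  simp only [jointMass, Finset.sum_filter, Function.comp_apply]
  exact e.sum_comp fun ω => if S ω = y ∧ X ω = b then m ω else 0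

theorem sum_jointMass_prodMk (m : Ω → ℝ) (S : Ω → Y) (T X : Ω → ZMod 2) (y : Y) (s : ZMod 2) :
    ∑ b, jointMass m (fun ω => (S ω, T ω)) X (y, s) b = jointMass m S T y s := by
  simp only [jointMass, Prod.mk.injEq, ← Finset.filter_filter]
  exact Finset.sum_fiberwise _ X m

theorem plusSource_jointMass (m : Ω → ℝ) (S : Ω → Y) (X : Ω → ZMod 2) :
    plusSource (jointMass m S X) =
      jointMass (fun ω : Ω × Ω => m ω.1 * m ω.2)
        (fun ω => ((S ω.1, S ω.2), X ω.1 + X ω.2)) (fun ω => X ω.2) := by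
  funext ⟨⟨y, z⟩, s⟩ b
  simp only [plusSource, jointMass]
  rw [Finset.sum_mul_sum, ← Finset.sum_product', ← Finset.filter_product, Finset.univ_product_univ]
  refine Finset.sum_congr (Finset.filter_congr fun ω _ => ?_) fun _ _ => rfl
  rw [← CharTwo.sub_eq_add s b, eq_sub_iff_add_eq]
  simp only [Prod.mk.injEq]
  constructor
  · rintro ⟨⟨hy, hs⟩, hz, rfl⟩
    exact ⟨⟨⟨hy, hz⟩, hs⟩, rfl⟩
  · rintro ⟨⟨⟨hy, hz⟩, hs⟩, rfl⟩
    exact ⟨⟨hy, hs⟩, hz, rfl⟩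

theorem minusSource_jointMass (m : Ω → ℝ) (S : Ω → Y) (X : Ω → ZMod 2) :
    minusSource (jointMass m S X) =
      jointMass (fun ω : Ω × Ω => m ω.1 * m ω.2) (fun ω => (S ω.1, S ω.2))
        (fun ω => X ω.1 + X ω.2) := by
  funext o s
  simp only [minusSource, plusSource_jointMass, sum_jointMass_prodMk]

variable [Fintype Y]

theorem sum_sum_jointMass_mul (m : Ω → ℝ) (S : Ω → Y) (X : Ω → ZMod 2) (g : Y → ZMod 2 → ℝ) :
    ∑ y, ∑ b, jointMass m S X y b * g y b = ∑ ω, m ω * g (S ω) (X ω) := by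
  rw [← Finset.sum_fiberwise Finset.univ (fun ω => (S ω, X ω)), Fintype.sum_prod_type]
  refine Finset.sum_congr rfl fun y _ => Finset.sum_congr rfl fun b _ => ?_
  rw [jointMass, Finset.sum_mul]
  refine Finset.sum_congr (by simp only [Prod.mk.injEq]) fun ω hω => ?_
  obtain ⟨rfl, rfl⟩ := Prod.mk.inj (Finset.mem_filter.1 hω).2
  rfl

theorem isSource_jointMass (hm : ∀ ω, 0 ≤ m ω) (hsum : ∑ ω, m ω = 1) :
    IsSource (jointMass m S X) where
  nonneg := jointMass_nonneg hm
  total := by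
    have h := sum_sum_jointMass_mul m S X fun _ _ => 1
    simpa only [sourceSum, mul_one, sum_zmod_two, hsum] using h

theorem sourceSum_jointMass_eq_sum_image {F : ℝ → ℝ → ℝ} (hF : F 0 0 = 0) (m : Ω → ℝ)
    (S : Ω → Y) (X : Ω → ZMod 2) :
    sourceSum F (jointMass m S X) =
      ∑ y ∈ Finset.univ.image S, F (jointMass m S X y 0) (jointMass m S X y 1) := by
  refine (Finset.sum_subset (Finset.subset_univ _) fun y _ hy => ?_).symm
  have hy' : ∀ ω, S ω ≠ y := by simpa using hy
  rw [jointMass_eq_zero hy', jointMass_eq_zero hy', hF]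

theorem sourceSum_jointMass_congr {Z : Type*} [Fintype Z] [DecidableEq Z] {F : ℝ → ℝ → ℝ}
    (hF : F 0 0 = 0) (m : Ω → ℝ) {S : Ω → Y} {T : Ω → Z} (X : Ω → ZMod 2)
    (hST : ∀ ω₁ ω₂, S ω₁ = S ω₂ ↔ T ω₁ = T ω₂) :
    sourceSum F (jointMass m S X) = sourceSum F (jointMass m T X) := by
  rcases isEmpty_or_nonempty Ω with hΩ | hΩ
  · simp [sourceSum, jointMass, hF]
  have : Nonempty Z := hΩ.map T
  obtain ⟨r, rfl⟩ := (Function.factorsThrough_iff T).1 fun ω₁ ω₂ h => (hST ω₁ ω₂).1 h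
  have hr : Set.InjOn r (Finset.univ.image S) := by
    intro y hy z hz hyz
    simp only [Finset.coe_image, Finset.coe_univ, Set.image_univ, Set.mem_range] at hy hz
    obtain ⟨ω₁, rfl⟩ := hy
    obtain ⟨ω₂, rfl⟩ := hz
    exact (hST ω₁ ω₂).2 hyz
  rw [sourceSum_jointMass_eq_sum_image hF, sourceSum_jointMass_eq_sum_image hF,
    ← Finset.image_image, Finset.sum_image hr]
  have hmass : ∀ ω b, jointMass m (r ∘ S) X (r (S ω)) b = jointMass m S X (S ω) b := fun ω b =>
    Finset.sum_congr (Finset.filter_congr fun ω' _ => by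
      rw [hST ω' ω, Function.comp_apply, Function.comp_apply]) fun _ _ => rfl
  refine Finset.sum_congr rfl fun y hy => ?_
  obtain ⟨ω, -, rfl⟩ := Finset.mem_image.1 hy
  rw [hmass, hmass]

theorem sum_mul_ite_le_two_mul_min (a : ZMod 2 → ℝ) (ha : ∀ b, 0 ≤ a b) :
    ∑ b, a b * (if a b ≤ a (b + 1) then 1 else 0) ≤ 2 * min (a 0) (a 1) := by
  have h0 := ha 0
  have h1 := ha 1
  simp only [sum_zmod_two, zero_add, CharTwo.add_self_eq_zero, mul_ite, mul_one, mul_zero]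
  rcases lt_trichotomy (a 0) (a 1) with h | h | h
  · rw [if_pos h.le, if_neg h.not_ge, min_eq_left h.le]
    linarith
  · rw [if_pos h.le, if_pos h.ge, min_eq_left h.le]
    linarith
  · rw [if_neg h.not_ge, if_pos h.le, min_eq_right h.le]
    linarith

theorem sum_filter_jointMass_le (hm : ∀ ω, 0 ≤ m ω) :
    ∑ ω with jointMass m S X (S ω) (X ω) ≤ jointMass m S X (S ω) (X ω + 1), m ω ≤
      2 * sourceSum min (jointMass m S X) := by
  calc ∑ ω with jointMass m S X (S ω) (X ω) ≤ jointMass m S X (S ω) (X ω + 1), m ω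
      = ∑ y, ∑ b, jointMass m S X y b *
          (if jointMass m S X y b ≤ jointMass m S X y (b + 1) then 1 else 0) := by
        rw [sum_sum_jointMass_mul m S X fun y b =>
          if jointMass m S X y b ≤ jointMass m S X y (b + 1) then 1 else 0]
        simp only [mul_ite, mul_one, mul_zero, Finset.sum_filter]
    _ ≤ ∑ y, 2 * min (jointMass m S X y 0) (jointMass m S X y 1) :=
        Finset.sum_le_sum fun y _ => sum_mul_ite_le_two_mul_min _ (jointMass_nonneg hm y)
    _ = 2 * sourceSum min (jointMass m S X) := (Finset.mul_sum _ _ _).symm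

end JointMass

/-! ### Polarization on a binary tree -/

section PolarTree

open Real Filter

/-- The two children `2 k` and `2 k + 1`, at level `n + 1`, of the node `k` at level `n` of the
binary tree. -/
def childEquiv (n : ℕ) : Fin (2 ^ n) × Fin 2 ≃ Fin (2 ^ (n + 1)) :=
  finProdFinEquiv.trans (finCongr (pow_succ 2 n).symm)

theorem sum_level_succ {M : Type*} [AddCommMonoid M] {n : ℕ} (g : Fin (2 ^ (n + 1)) → M) :
    ∑ i, g i = ∑ i, (g (childEquiv n (i, 0)) + g (childEquiv n (i, 1))) := by
  rw [← (childEquiv n).sum_comp, Fintype.sum_prod_type]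
  simp only [Fin.sum_univ_two]

/-- Bhattacharyya parameters `Z` and entropies `E` (in nats) on the nodes of the binary tree,
subject to the laws of a polarization step: the left child is the harder half of the step and the
right child is the easier one. -/
structure IsPolarTree (Z E : (n : ℕ) → Fin (2 ^ n) → ℝ) : Prop where
  nonneg : ∀ n i, 0 ≤ Z n i
  le_one : ∀ n i, Z n i ≤ 1
  minus_le : ∀ n i, Z (n + 1) (childEquiv n (i, 0)) ≤ 2 * Z n i - Z n i ^ 2
  plus_le : ∀ n i, Z (n + 1) (childEquiv n (i, 1)) ≤ Z n i ^ 2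
  entropy_nonneg : ∀ n i, 0 ≤ E n i
  entropy_add : ∀ n i, E (n + 1) (childEquiv n (i, 0)) + E (n + 1) (childEquiv n (i, 1)) = 2 * E n i
  le_entropy : ∀ n i, log 2 - 2 * (1 - Z n i) ≤ E n i

theorem sqrt_add_sqrt_sq_le {z : ℝ} (h0 : 0 ≤ z) (h1 : z ≤ 1) :
    √(2 * z - z ^ 2) + √(z ^ 2) ≤ 2 * √z - √z * (1 - √z) ^ 2 / 2 := by
  obtain ⟨s, hs, rfl⟩ : ∃ s, 0 ≤ s ∧ s ^ 2 = z := ⟨√z, sqrt_nonneg z, sq_sqrt h0⟩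
  have hminus : √(2 * s ^ 2 - (s ^ 2) ^ 2) ≤ s * (2 - s - (1 - s) ^ 2 / 2) := by
    refine sqrt_le_iff.2 ⟨mul_nonneg hs (by linarith), ?_⟩
    nlinarith [sq_nonneg (s * (1 - s) * (1 + s) / 2)]
  rw [sqrt_sq hs, sqrt_sq (sq_nonneg s)]
  linarith

/-- The potential of a node in the second phase: the linear term makes it trivial for `z` above
`1 / 256`, and below that `√√z` contracts on average by the factor `3 / 4` in a polarization
step. -/
noncomputable def contractionPotential (c z : ℝ) : ℝ := min 1 (256 * z + c * √√z)

theorem sqrt_sqrt_le {x y : ℝ} (hy : 0 ≤ y) (h : x ≤ y ^ 4) : √√x ≤ y :=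
  sqrt_le_iff.2 ⟨hy, sqrt_le_iff.2 ⟨by positivity, by rwa [← pow_mul]⟩⟩

theorem sqrt_sqrt_pow_four {z : ℝ} (hz : 0 ≤ z) : √√z ^ 4 = z := by
  rw [show 4 = 2 * 2 from rfl, pow_mul, sq_sqrt (sqrt_nonneg z), sq_sqrt hz]

theorem sqrt_sqrt_add_sqrt_sqrt_le {z x y : ℝ} (hz : 0 ≤ z) (hz' : z ≤ 1 / 256)
    (hx : x ≤ 2 * z - z ^ 2) (hy : y ≤ z ^ 2) : √√x + √√y ≤ 3 / 2 * √√z := by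
  have hq := sqrt_sqrt_pow_four hz
  have hq0 : 0 ≤ √√z := sqrt_nonneg _
  have hq1 : √√z ≤ 1 / 4 := sqrt_sqrt_le (by norm_num) (by linarith)
  have hminus : √√x ≤ 5 / 4 * √√z := sqrt_sqrt_le (by positivity) (by rw [mul_pow, hq]; nlinarith)
  have hplus : √√y ≤ √√z ^ 2 := sqrt_sqrt_le (by positivity) (by
    rw [← pow_mul, mul_comm, pow_mul, hq]
    exact hy)
  nlinarith

theorem contractionPotential_add_le {c z x y : ℝ} (hc : 0 ≤ c) (hz : 0 ≤ z)
    (hx : x ≤ 2 * z - z ^ 2) (hy : y ≤ z ^ 2) :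
    contractionPotential c x + contractionPotential c y ≤
      2 * contractionPotential (3 / 4 * c) z := by
  have hx1 : contractionPotential c x ≤ 1 := min_le_left _ _
  have hy1 : contractionPotential c y ≤ 1 := min_le_left _ _
  rw [contractionPotential.eq_def _ z, mul_min_of_nonneg _ _ zero_le_two]
  refine le_min (by linarith) ?_
  rcases le_total z (1 / 256) with hz' | hz'
  · have hx2 : contractionPotential c x ≤ 256 * x + c * √√x := min_le_right _ _
    have hy2 : contractionPotential c y ≤ 256 * y + c * √√y := min_le_right _ _
    have hroot := mul_le_mul_of_nonneg_left (sqrt_sqrt_add_sqrt_sqrt_le hz hz' hx hy) hc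
    linarith
  · have : 0 ≤ 3 / 4 * c * √√z := by positivity
    linarith

theorem contractionPotential_le {c z ζ : ℝ} (hc : 0 ≤ c) (hζ : 0 ≤ ζ) (hz : z ≤ 1) :
    contractionPotential c z ≤ (if ζ < z then 1 else 0) + (256 * ζ + c) := by
  split_ifs with h
  · exact (min_le_left _ _).trans (by linarith)
  · have hroot : √√z ≤ 1 := sqrt_sqrt_le zero_le_one (by linarith)
    exact (min_le_right _ _).trans (by nlinarith)

theorem contractionPotential_eq_one {θ z : ℝ} (hθ : 0 < θ) (hz : θ ^ 4 ≤ z) :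
    contractionPotential θ⁻¹ z = 1 := by
  have hz0 : 0 ≤ z := le_trans (by positivity) hz
  have hroot : θ ≤ √√z :=
    le_of_pow_le_pow_left₀ four_ne_zero (sqrt_nonneg _) (hz.trans_eq (sqrt_sqrt_pow_four hz0).symm)
  have : 1 ≤ θ⁻¹ * √√z := by rwa [← div_eq_inv_mul, one_le_div hθ]
  exact min_eq_left (by linarith)

namespace IsPolarTree

variable {Z E : (n : ℕ) → Fin (2 ^ n) → ℝ}

theorem sum_entropy (h : IsPolarTree Z E) (n : ℕ) : ∑ i, E n i = 2 ^ n * E 0 0 := by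
  induction n with
  | zero => simp
  | succ n ih =>
    simp only [sum_level_succ, h.entropy_add, ← Finset.mul_sum, ih]
    ring

theorem sum_sqrt_succ_le (h : IsPolarTree Z E) (n : ℕ) :
    ∑ i, √(Z (n + 1) i) ≤ 2 * ∑ i, √(Z n i) - (∑ i, √(Z n i) * (1 - √(Z n i)) ^ 2) / 2 := by
  rw [sum_level_succ, Finset.mul_sum, Finset.sum_div, ← Finset.sum_sub_distrib]
  refine Finset.sum_le_sum fun i _ => ?_
  exact (add_le_add (sqrt_le_sqrt (h.minus_le n i)) (sqrt_le_sqrt (h.plus_le n i))).trans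
    (sqrt_add_sqrt_sq_le (h.nonneg n i) (h.le_one n i))

theorem exists_sum_sqrt_mul_le (h : IsPolarTree Z E) {η : ℝ} (hη : 0 < η) :
    ∃ n, ∑ i, √(Z n i) * (1 - √(Z n i)) ^ 2 ≤ 2 ^ n * η := by
  by_contra! hlarge
  have hsum : ∀ n : ℕ, ∑ i, √(Z n i) ≤ 2 ^ n * (1 - n * (η / 4)) := by
    intro n
    induction n with
    | zero => simpa using h.le_one 0 0
    | succ n ih =>
      have hpow : (2 : ℝ) ^ (n + 1) = 2 ^ n * 2 := pow_succ 2 n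
      rw [hpow, Nat.cast_succ]
      linarith [h.sum_sqrt_succ_le n, hlarge n]
  obtain ⟨n, hn⟩ := exists_nat_gt (1 / (η / 4))
  rw [div_lt_iff₀ (by positivity)] at hn
  have hneg : 2 ^ n * (1 - n * (η / 4)) < 0 := mul_neg_of_pos_of_neg (by positivity) (by linarith)
  have hnonneg : 0 ≤ ∑ i, √(Z n i) := Finset.sum_nonneg fun i _ => sqrt_nonneg _
  linarith [hsum n]

theorem one_le_entropy_or_le_sqrt_mul (h : IsPolarTree Z E) {ε ζ : ℝ} (hε : 0 ≤ ε) {n : ℕ}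
    {i : Fin (2 ^ n)} (hi : ζ < Z n i) :
    1 ≤ E n i / log 2 + ε ∨ √ζ * (ε * log 2 / 4) ^ 2 ≤ √(Z n i) * (1 - √(Z n i)) ^ 2 := by
  have hlog : 0 < log 2 := log_pos one_lt_two
  rcases le_total (1 - ε * log 2 / 2) (Z n i) with hZ | hZ
  · left
    rw [div_add' _ _ _ hlog.ne', one_le_div hlog]
    linarith [h.le_entropy n i]
  · right
    have hsq := sq_sqrt (h.nonneg n i)
    have hgap : ε * log 2 / 4 ≤ 1 - √(Z n i) := by nlinarith [sq_nonneg (1 - √(Z n i))]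
    gcongr

theorem exists_card_lt_le (h : IsPolarTree Z E) {ε ζ : ℝ} (hε : 0 < ε) (hζ : 0 < ζ) :
    ∃ n, ((Finset.univ.filter fun i => ζ < Z n i).card : ℝ) ≤ 2 ^ n * (E 0 0 / log 2 + 2 * ε) := by
  have hlog : 0 < log 2 := log_pos one_lt_two
  set κ := √ζ * (ε * log 2 / 4) ^ 2
  have hκ : 0 < κ := mul_pos (sqrt_pos.2 hζ) (by positivity)
  obtain ⟨n, hn⟩ := h.exists_sum_sqrt_mul_le (mul_pos hε hκ)
  refine ⟨n, ?_⟩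
  have hpoint : ∀ i, (if ζ < Z n i then 1 else 0) ≤
      E n i / log 2 + ε + √(Z n i) * (1 - √(Z n i)) ^ 2 / κ := by
    intro i
    have hE : 0 ≤ E n i / log 2 := div_nonneg (h.entropy_nonneg n i) hlog.le
    have hdrift : 0 ≤ √(Z n i) * (1 - √(Z n i)) ^ 2 / κ := by positivity
    split_ifs with hi
    · rcases h.one_le_entropy_or_le_sqrt_mul hε.le hi with h1 | h1
      · linarith
      · linarith [(one_le_div hκ).2 h1]
    · linarith
  calc ((Finset.univ.filter fun i => ζ < Z n i).card : ℝ)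
      = ∑ i, if ζ < Z n i then 1 else 0 := Finset.natCast_card_filter _ _
    _ ≤ ∑ i, (E n i / log 2 + ε + √(Z n i) * (1 - √(Z n i)) ^ 2 / κ) :=
        Finset.sum_le_sum fun i _ => hpoint i
    _ = 2 ^ n * E 0 0 / log 2 + 2 ^ n * ε + (∑ i, √(Z n i) * (1 - √(Z n i)) ^ 2) / κ := by
        simp only [Finset.sum_add_distrib, ← Finset.sum_div, h.sum_entropy,
          Finset.sum_const, Finset.card_univ, Fintype.card_fin, nsmul_eq_mul, Nat.cast_pow,
          Nat.cast_ofNat]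
    _ ≤ 2 ^ n * E 0 0 / log 2 + 2 ^ n * ε + 2 ^ n * ε := by
        rw [← mul_assoc] at hn
        gcongr
        exact (div_le_iff₀ hκ).2 hn
    _ = 2 ^ n * (E 0 0 / log 2 + 2 * ε) := by ring

theorem sum_contractionPotential_le (h : IsPolarTree Z E) (m k : ℕ) {c : ℝ} (hc : 0 ≤ c) :
    ∑ i, contractionPotential c (Z (m + k) i) ≤
      2 ^ k * ∑ i, contractionPotential ((3 / 4) ^ k * c) (Z m i) := by
  induction k generalizing c with
  | zero => simp
  | succ k ih =>
    calc ∑ i, contractionPotential c (Z (m + k + 1) i)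
        ≤ ∑ i, 2 * contractionPotential (3 / 4 * c) (Z (m + k) i) := by
          rw [sum_level_succ]
          exact Finset.sum_le_sum fun i _ => contractionPotential_add_le hc (h.nonneg _ i)
            (h.minus_le _ i) (h.plus_le _ i)
      _ ≤ 2 * (2 ^ k * ∑ i, contractionPotential ((3 / 4) ^ k * (3 / 4 * c)) (Z m i)) := by
          rw [← Finset.mul_sum]
          gcongr
          exact ih (by positivity)
      _ = 2 ^ (k + 1) * ∑ i, contractionPotential ((3 / 4) ^ (k + 1) * c) (Z m i) := by
          rw [← mul_assoc ((3 / 4 : ℝ) ^ k), ← pow_succ, ← mul_assoc 2, ← pow_succ']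

-- The rate `4 / 5` is chosen so that `3 / 4 < 4 / 5` and `2 * (4 / 5) ^ 4 < 1`.
theorem card_pow_lt_le (h : IsPolarTree Z E) (m k : ℕ) {ζ : ℝ} (hζ : 0 ≤ ζ) :
    ((Finset.univ.filter fun i => ((4 / 5 : ℝ) ^ k) ^ 4 < Z (m + k) i).card : ℝ) ≤
      2 ^ k * ((Finset.univ.filter fun i => ζ < Z m i).card +
        2 ^ m * (256 * ζ + (15 / 16) ^ k)) := by
  have hθ : (0 : ℝ) < (4 / 5) ^ k := by positivity
  have hc : (3 / 4) ^ k * ((4 / 5 : ℝ) ^ k)⁻¹ = (15 / 16) ^ k := by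
    rw [← inv_pow, ← mul_pow]
    norm_num
  calc ((Finset.univ.filter fun i => ((4 / 5 : ℝ) ^ k) ^ 4 < Z (m + k) i).card : ℝ)
      = ∑ i, if ((4 / 5 : ℝ) ^ k) ^ 4 < Z (m + k) i then 1 else 0 :=
        Finset.natCast_card_filter _ _
    _ ≤ ∑ i, contractionPotential ((4 / 5) ^ k)⁻¹ (Z (m + k) i) := by
        refine Finset.sum_le_sum fun i _ => ?_
        split_ifs with hi
        · exact (contractionPotential_eq_one hθ hi.le).ge
        · have := h.nonneg (m + k) i
          exact le_min zero_le_one (by positivity)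
    _ ≤ 2 ^ k * ∑ i, contractionPotential ((15 / 16) ^ k) (Z m i) :=
        hc ▸ h.sum_contractionPotential_le m k (inv_nonneg.2 hθ.le)
    _ ≤ 2 ^ k * ∑ i, ((if ζ < Z m i then 1 else 0) + (256 * ζ + (15 / 16) ^ k)) := by
        gcongr with i
        exact contractionPotential_le (by positivity) hζ (h.le_one m i)
    _ = _ := by simp [Finset.sum_add_distrib, mul_add]

theorem eventually_card_pow_lt_le (h : IsPolarTree Z E) {ε : ℝ} (hε : 0 < ε) :
    ∃ m, ∀ᶠ k in atTop,
      ((Finset.univ.filter fun i => ((4 / 5 : ℝ) ^ k) ^ 4 < Z (m + k) i).card : ℝ) ≤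
        2 ^ (m + k) * (E 0 0 / log 2 + 4 * ε) := by
  obtain ⟨m, hm⟩ := h.exists_card_lt_le hε (ζ := ε / 256) (by positivity)
  have hlim : Tendsto (fun k : ℕ => (15 / 16 : ℝ) ^ k) atTop (nhds 0) :=
    tendsto_pow_atTop_nhds_zero_of_lt_one (by norm_num) (by norm_num)
  refine ⟨m, (hlim.eventually_le_const hε).mono fun k hk => ?_⟩
  calc _ ≤ _ := h.card_pow_lt_le m k (ζ := ε / 256) (by positivity)
    _ ≤ 2 ^ k * (2 ^ m * (E 0 0 / log 2 + 2 * ε) + 2 ^ m * (256 * (ε / 256) + ε)) := by gcongr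
    _ = 2 ^ (m + k) * (E 0 0 / log 2 + 4 * ε) := by ring

theorem exists_eventually_le_card (h : IsPolarTree Z E) {δ : ℝ} (hδ : 0 < δ) :
    ∃ t : ℕ → ℝ, Tendsto (fun n => 2 ^ n * t n) atTop (nhds 0) ∧ ∀ᶠ n in atTop,
      (1 - E 0 0 / log 2 - δ) * 2 ^ n ≤ (Finset.univ.filter fun i => Z n i ≤ t n).card := by
  obtain ⟨m, hm⟩ := h.eventually_card_pow_lt_le (ε := δ / 4) (by positivity)
  refine ⟨fun n => ((4 / 5) ^ n / (4 / 5) ^ m) ^ 4, ?_, ?_⟩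
  · have hlim := (tendsto_pow_atTop_nhds_zero_of_lt_one (r := (2 * (4 / 5) ^ 4 : ℝ)) (by norm_num)
      (by norm_num)).div_const (((4 / 5) ^ m) ^ 4)
    rw [zero_div] at hlim
    refine hlim.congr fun n => ?_
    rw [mul_pow, pow_right_comm _ 4 n, mul_div_assoc, ← div_pow]
  · obtain ⟨k₀, hk₀⟩ := eventually_atTop.1 hm
    refine (eventually_ge_atTop (m + k₀)).mono fun n hn => ?_
    obtain ⟨k, rfl⟩ : ∃ k, n = m + k := ⟨n - m, by omega⟩
    have hcard : ((Finset.univ.filter fun i => ((4 / 5 : ℝ) ^ k) ^ 4 < Z (m + k) i).card : ℝ) +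
        (Finset.univ.filter fun i => Z (m + k) i ≤ ((4 / 5 : ℝ) ^ k) ^ 4).card = 2 ^ (m + k) := by
      simpa only [not_lt, Finset.card_univ, Fintype.card_fin, Nat.cast_add, Nat.cast_pow,
        Nat.cast_ofNat] using congrArg (Nat.cast : ℕ → ℝ) (Finset.card_filter_add_card_filter_not
          (s := Finset.univ) fun i => ((4 / 5 : ℝ) ^ k) ^ 4 < Z (m + k) i)
    have hshift : (4 / 5 : ℝ) ^ (m + k) / (4 / 5) ^ m = (4 / 5) ^ k := by
      rw [pow_add, mul_div_cancel_left₀ _ (by positivity)]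
    beta_reduce
    rw [hshift]
    linarith [hk₀ k (by omega)]

end IsPolarTree

end PolarTree

/-! ### The recursion of the polar transform -/

section Recursion

/-- The position, in the left half for `c = 0` and in the right half for `c = 1`, of the letter `l`
of a word that consists of two halves. -/
def halfEquiv (ν : ℕ) : Fin 2 × Fin (2 ^ ν) ≃ Fin (2 ^ (ν + 1)) :=
  finProdFinEquiv.trans (finCongr (pow_succ' 2 ν).symm)

theorem polarTransform_succ_apply {ν : ℕ} (k l : Fin (2 ^ ν)) (c d : Fin 2) :
    polarTransform (ν + 1) (childEquiv ν (k, c)) (halfEquiv ν (d, l)) =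
      polarKernel c d * polarTransform ν k l := by
  simp only [polarTransform, childEquiv, halfEquiv, Equiv.trans_apply, Matrix.reindex_apply,
    Matrix.submatrix_apply, Equiv.symm_apply_apply, Matrix.mul_apply, reverseShuffleMatrix,
    Matrix.of_apply, Matrix.kroneckerMap_apply]
  have sum_positions (g : Fin (2 ^ ν * 2) → ZMod 2) :
      ∑ j, g j = ∑ k, ∑ c, g (finProdFinEquiv (k, c)) := by
    rw [← finProdFinEquiv.sum_comp, Fintype.sum_prod_type]
  rw [← finProdFinEquiv.sum_comp, Fintype.sum_prod_type]
  simp only [sum_positions, Equiv.symm_apply_apply, reverseShuffle, Equiv.trans_apply,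
    Equiv.prodComm_apply, Prod.swap_prod_mk, EmbeddingLike.apply_eq_iff_eq, Prod.mk.injEq,
    Matrix.one_apply]
  simp [ite_and]

/-- The bijection `u ↦ (a, b)` with `a_k = u_{2k} + u_{2k+1}` and `b_k = u_{2k+1}`, which conjugates
`G_{2N}` to two copies of `G_N`. -/
def polarSplit (ν : ℕ) : (Fin (2 ^ (ν + 1)) → ZMod 2) ≃
    (Fin (2 ^ ν) → ZMod 2) × (Fin (2 ^ ν) → ZMod 2) where
  toFun u := (fun k => u (childEquiv ν (k, 0)) + u (childEquiv ν (k, 1)),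
    fun k => u (childEquiv ν (k, 1)))
  invFun w j :=
    let i := (childEquiv ν).symm j
    if i.2 = 0 then w.1 i.1 + w.2 i.1 else w.2 i.1
  left_inv u := by
    funext j
    obtain ⟨⟨k, c⟩, rfl⟩ := (childEquiv ν).surjective j
    fin_cases c <;> simp [add_assoc, CharTwo.add_self_eq_zero]
  right_inv w := by
    ext k <;> simp [add_assoc, CharTwo.add_self_eq_zero]

variable {ν : ℕ}

theorem apply_childEquiv_zero (u : Fin (2 ^ (ν + 1)) → ZMod 2) (k : Fin (2 ^ ν)) :
    u (childEquiv ν (k, 0)) = (polarSplit ν u).1 k + (polarSplit ν u).2 k := by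
  simp [polarSplit, add_assoc, CharTwo.add_self_eq_zero]

theorem apply_childEquiv_one (u : Fin (2 ^ (ν + 1)) → ZMod 2) (k : Fin (2 ^ ν)) :
    u (childEquiv ν (k, 1)) = (polarSplit ν u).2 k :=
  rfl

theorem vecMul_polarTransform_succ_zero (u : Fin (2 ^ (ν + 1)) → ZMod 2) (l : Fin (2 ^ ν)) :
    Matrix.vecMul u (polarTransform (ν + 1)) (halfEquiv ν (0, l)) =
      Matrix.vecMul (polarSplit ν u).1 (polarTransform ν) l := by
  simp only [Matrix.vecMul, dotProduct, sum_level_succ, polarTransform_succ_apply]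
  simp [polarKernel, polarSplit, add_mul]

theorem vecMul_polarTransform_succ_one (u : Fin (2 ^ (ν + 1)) → ZMod 2) (l : Fin (2 ^ ν)) :
    Matrix.vecMul u (polarTransform (ν + 1)) (halfEquiv ν (1, l)) =
      Matrix.vecMul (polarSplit ν u).2 (polarTransform ν) l := by
  simp only [Matrix.vecMul, dotProduct, sum_level_succ, polarTransform_succ_apply]
  simp [polarKernel, polarSplit]

theorem vecMul_polarTransform_injective (ν : ℕ) :
    Function.Injective fun u => Matrix.vecMul u (polarTransform ν) := by
  induction ν with
  | zero =>
    intro u v h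
    simpa [polarTransform] using h
  | succ ν ih =>
    intro u v h
    refine (polarSplit ν).injective (Prod.ext (ih (funext fun l => ?_)) (ih (funext fun l => ?_)))
    · simpa only [vecMul_polarTransform_succ_zero] using congrFun h (halfEquiv ν (0, l))
    · simpa only [vecMul_polarTransform_succ_one] using congrFun h (halfEquiv ν (1, l))

/-- The polar transform `u ↦ u G_N` as a bijection. -/
noncomputable def polarEquiv (ν : ℕ) : (Fin (2 ^ ν) → ZMod 2) ≃ (Fin (2 ^ ν) → ZMod 2) :=
  Equiv.ofBijective (fun u => Matrix.vecMul u (polarTransform ν))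
    (Finite.injective_iff_bijective.1 (vecMul_polarTransform_injective ν))

theorem polarEquiv_apply (u : Fin (2 ^ ν) → ZMod 2) :
    polarEquiv ν u = Matrix.vecMul u (polarTransform ν) :=
  rfl

/-- The probability of the word `u` when the bits of `u G_N` are independent and equal to `1` with
probability `p`. -/
def wordMass (p : ℝ) (u : Fin (2 ^ ν) → ZMod 2) : ℝ :=
  ∏ j, bitMass p (Matrix.vecMul u (polarTransform ν) j)

theorem wordMass_succ (p : ℝ) (u : Fin (2 ^ (ν + 1)) → ZMod 2) :
    wordMass p u = wordMass p (polarSplit ν u).1 * wordMass p (polarSplit ν u).2 := by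
  rw [wordMass, ← (halfEquiv ν).prod_comp, Fintype.prod_prod_type, Fin.prod_univ_two]
  simp only [vecMul_polarTransform_succ_zero, vecMul_polarTransform_succ_one, wordMass]

theorem sum_prod_bitMass (p : ℝ) (N : ℕ) : ∑ x : Fin N → ZMod 2, ∏ j, bitMass p (x j) = 1 := by
  rw [← Fintype.prod_sum]
  simp [sum_zmod_two, bitMass]

theorem sum_wordMass (p : ℝ) (ν : ℕ) : ∑ u : Fin (2 ^ ν) → ZMod 2, wordMass p u = 1 := by
  rw [← sum_prod_bitMass p (2 ^ ν)]
  exact (polarEquiv ν).sum_comp fun x => ∏ j, bitMass p (x j)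

theorem bitMass_nonneg {p : ℝ} (hp : p ∈ Set.Icc 0 1) (b : ZMod 2) : 0 ≤ bitMass p b := by
  unfold bitMass
  split_ifs <;> linarith [hp.1, hp.2]

theorem wordMass_nonneg {p : ℝ} (hp : p ∈ Set.Icc 0 1) (u : Fin (2 ^ ν) → ZMod 2) :
    0 ≤ wordMass p u :=
  Finset.prod_nonneg fun _ _ => bitMass_nonneg hp _

theorem childEquiv_lt_childEquiv {k i : Fin (2 ^ ν)} {c d : Fin 2} :
    childEquiv ν (k, c) < childEquiv ν (i, d) ↔ k < i ∨ k = i ∧ c < d := by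
  simp only [childEquiv, Equiv.trans_apply, finCongr_apply, Fin.lt_def, Fin.val_cast,
    finProdFinEquiv_apply_val, Fin.ext_iff]
  omega

/-- The letters `u_j`, `j < i`, of the word `u`. -/
def wordPrefix (i : Fin (2 ^ ν)) (u : Fin (2 ^ ν) → ZMod 2) (j : {j : Fin (2 ^ ν) // j < i}) :
    ZMod 2 :=
  u j

theorem wordPrefix_eq_iff {i : Fin (2 ^ ν)} {u v : Fin (2 ^ ν) → ZMod 2} :
    wordPrefix i u = wordPrefix i v ↔ ∀ j < i, u j = v j := by
  simp only [funext_iff, Subtype.forall, wordPrefix]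

theorem wordPrefix_childEquiv_zero_eq_iff {i : Fin (2 ^ ν)} {u v : Fin (2 ^ (ν + 1)) → ZMod 2} :
    wordPrefix (childEquiv ν (i, 0)) u = wordPrefix (childEquiv ν (i, 0)) v ↔
      wordPrefix i (polarSplit ν u).1 = wordPrefix i (polarSplit ν v).1 ∧
        wordPrefix i (polarSplit ν u).2 = wordPrefix i (polarSplit ν v).2 := by
  simp only [wordPrefix_eq_iff, ← (childEquiv ν).forall_congr_right, Prod.forall,
    Fin.forall_fin_two, childEquiv_lt_childEquiv, apply_childEquiv_zero, apply_childEquiv_one,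
    Fin.not_lt_zero, and_false, or_false]
  simp only [← forall_and]
  refine forall_congr' fun j => ?_
  grind

theorem wordPrefix_childEquiv_one_eq_iff {i : Fin (2 ^ ν)} {u v : Fin (2 ^ (ν + 1)) → ZMod 2} :
    wordPrefix (childEquiv ν (i, 1)) u = wordPrefix (childEquiv ν (i, 1)) v ↔
      wordPrefix (childEquiv ν (i, 0)) u = wordPrefix (childEquiv ν (i, 0)) v ∧
        u (childEquiv ν (i, 0)) = v (childEquiv ν (i, 0)) := by
  simp only [wordPrefix_eq_iff, ← (childEquiv ν).forall_congr_right, Prod.forall,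
    Fin.forall_fin_two, childEquiv_lt_childEquiv, apply_childEquiv_zero, apply_childEquiv_one]
  grind

/-- The source with bit `U_i` and side information `U₁^{i-1}`, where `U` is the word whose polar
transform has independent bits that equal `1` with probability `p`. -/
def polarSource (p : ℝ) (i : Fin (2 ^ ν)) : ({j : Fin (2 ^ ν) // j < i} → ZMod 2) → ZMod 2 → ℝ :=
  jointMass (wordMass p) (wordPrefix i) fun u => u i

theorem isSource_polarSource {p : ℝ} (hp : p ∈ Set.Icc 0 1) (i : Fin (2 ^ ν)) :
    IsSource (polarSource p i) :=
  isSource_jointMass (wordMass_nonneg hp) (sum_wordMass p ν)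

theorem prefixMass_eq_polarSource (p : ℝ) (u : Fin (2 ^ ν) → ZMod 2) (i : Fin (2 ^ ν))
    (b : ZMod 2) : prefixMass p u i b = polarSource p i (wordPrefix i u) b := by
  simp only [prefixMass, polarSource, jointMass, wordPrefix_eq_iff, wordMass]

theorem sourceSum_polarSource_childEquiv_zero {F : ℝ → ℝ → ℝ} (hF : F 0 0 = 0) (p : ℝ)
    (i : Fin (2 ^ ν)) :
    sourceSum F (polarSource p (childEquiv ν (i, 0))) =
      sourceSum F (minusSource (polarSource p i)) := by
  rw [polarSource, polarSource, minusSource_jointMass, ← jointMass_comp_equiv (polarSplit ν)]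
  simp only [Function.comp_def, ← wordMass_succ, ← apply_childEquiv_zero]
  exact sourceSum_jointMass_congr hF _ _ fun u v => by
    simp only [wordPrefix_childEquiv_zero_eq_iff, Prod.mk.injEq]

theorem sourceSum_polarSource_childEquiv_one {F : ℝ → ℝ → ℝ} (hF : F 0 0 = 0) (p : ℝ)
    (i : Fin (2 ^ ν)) :
    sourceSum F (polarSource p (childEquiv ν (i, 1))) =
      sourceSum F (plusSource (polarSource p i)) := by
  rw [polarSource, polarSource, plusSource_jointMass, ← jointMass_comp_equiv (polarSplit ν)]
  simp only [Function.comp_def, ← wordMass_succ, ← apply_childEquiv_zero]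
  exact sourceSum_jointMass_congr hF _ _ fun u v => by
    simp only [wordPrefix_childEquiv_one_eq_iff, wordPrefix_childEquiv_zero_eq_iff, Prod.mk.injEq]

theorem isPolarTree_polarSource {p : ℝ} (hp : p ∈ Set.Icc 0 1) :
    IsPolarTree (fun _ i => bhattacharyya (polarSource p i))
      (fun _ i => condEntropy (polarSource p i)) where
  nonneg _ i := bhattacharyya_nonneg _
  le_one _ i := (isSource_polarSource hp i).bhattacharyya_le_one
  minus_le _ i := by
    rw [bhattacharyya, sourceSum_polarSource_childEquiv_zero (by simp)]
    exact (isSource_polarSource hp i).bhattacharyya_minusSource_le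
  plus_le _ i := by
    rw [bhattacharyya, sourceSum_polarSource_childEquiv_one (by simp)]
    exact (isSource_polarSource hp i).bhattacharyya_plusSource.le
  entropy_nonneg _ i := (isSource_polarSource hp i).condEntropy_nonneg
  entropy_add _ i := by
    rw [condEntropy, condEntropy, sourceSum_polarSource_childEquiv_zero (by simp [bitEntropy]),
      sourceSum_polarSource_childEquiv_one (by simp [bitEntropy])]
    exact (isSource_polarSource hp i).condEntropy_minusSource_add_condEntropy_plusSource
  le_entropy _ i := (isSource_polarSource hp i).log_two_sub_le_condEntropy

theorem polarSource_root (p : ℝ) (v : {j : Fin (2 ^ 0) // j < 0} → ZMod 2) (b : ZMod 2) :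
    polarSource p (0 : Fin (2 ^ 0)) v b = bitMass p b := by
  have hv : ∀ u, wordPrefix 0 u = v := fun u => funext fun j => absurd j.2 (Fin.not_lt_zero _)
  simp only [polarSource, jointMass, hv, true_and, wordMass, polarTransform, Matrix.vecMul_one]
  have hb : (Finset.univ.filter fun u : Fin (2 ^ 0) → ZMod 2 => u 0 = b) = {fun _ => b} := by
    ext u
    simp [funext_iff, Fin.forall_fin_one]
  rw [hb, Finset.sum_singleton]
  exact Fin.prod_univ_one _

theorem condEntropy_polarSource_root (p : ℝ) :
    condEntropy (polarSource p (0 : Fin (2 ^ 0))) = Real.binEntropy p := by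
  have : IsEmpty {j : Fin (2 ^ 0) // j < 0} := ⟨fun j => absurd j.2 (Fin.not_lt_zero _)⟩
  simp only [condEntropy, sourceSum, polarSource_root, Fintype.sum_unique, bitMass]
  rw [if_pos trivial, if_neg one_ne_zero, bitEntropy_comm, bitEntropy_self_one_sub]

end Recursion

/-! ### Capacities of the effective channels -/

section Capacity

open Real

theorem mul_logb_div_half_add_half {a b : ℝ} (ha : 0 ≤ a) (hb : 0 ≤ b) :
    a * logb 2 (a / (1 / 2 * a + 1 / 2 * b)) = a + (a * log a - a * log (a + b)) / log 2 := by
  rcases ha.eq_or_lt with rfl | ha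
  · simp
  have hl : log 2 ≠ 0 := (log_pos one_lt_two).ne'
  have hab : a + b ≠ 0 := by positivity
  have hdiv : a / (1 / 2 * a + 1 / 2 * b) = 2 * (a / (a + b)) := by
    field_simp
  rw [hdiv, logb, log_mul two_ne_zero (by positivity), log_div ha.ne' hab]
  field_simp

theorem capacity_eq_sub_sum_bitEntropy {Y : Type*} [Fintype Y] {W : ZMod 2 → Y → ℝ}
    (hW : ∀ b y, 0 ≤ W b y) :
    capacity W = (∑ y, (W 0 y + W 1 y) - (∑ y, bitEntropy (W 0 y) (W 1 y)) / log 2) / 2 := by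
  rw [capacity, Finset.sum_div, ← Finset.sum_sub_distrib, Finset.sum_div]
  refine Finset.sum_congr rfl fun y _ => ?_
  have h0 := mul_logb_div_half_add_half (hW 0 y) (hW 1 y)
  have h1 := mul_logb_div_half_add_half (hW 1 y) (hW 0 y)
  rw [add_comm (1 / 2 * W 1 y), add_comm (W 1 y) (W 0 y)] at h1
  rw [sum_zmod_two, mul_assoc, mul_assoc, h0, h1]
  simp only [bitEntropy, negMulLog]
  ring

variable {ν : ℕ}

-- The substitution `u = x - w` turns the channel law given `x` into the law of the error pattern.
theorem effectiveChannel_polarEquiv (p : ℝ) (i : Fin (2 ^ ν)) (b : ZMod 2)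
    (x : Fin (2 ^ ν) → ZMod 2) (v : {j : Fin (2 ^ ν) // j < i} → ZMod 2) :
    effectiveChannel p i b (polarEquiv ν x, v) =
      (1 / 2) ^ (2 ^ ν - 1) * polarSource p i (wordPrefix i x - v) (x i - b) := by
  have hmem : ∀ w : Fin (2 ^ ν) → ZMod 2,
      ((∀ j : {j // j < i}, (x - w) j.1 = v j) ∧ (x - w) i = b) ↔
        wordPrefix i w = wordPrefix i x - v ∧ w i = x i - b := fun w => by
    rw [funext_iff]
    refine and_congr (forall_congr' fun j => ?_) ?_
    · exact sub_eq_iff_comm.trans eq_comm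
    · exact sub_eq_iff_comm.trans eq_comm
  have hmass : ∀ w : Fin (2 ^ ν) → ZMod 2,
      ∏ j, bsc p (Matrix.vecMul (x - w) (polarTransform ν) j) (polarEquiv ν x j) =
        wordMass p w := fun w => by
    simp only [bsc, polarEquiv_apply, Matrix.sub_vecMul, Pi.sub_apply, sub_sub_cancel, wordMass]
  simp only [effectiveChannel, polarSource, jointMass, Finset.sum_filter]
  rw [← (Equiv.subLeft x).sum_comp]
  simp only [Equiv.subLeft_apply, hmem, hmass]

theorem sum_effectiveChannel (p : ℝ) (i : Fin (2 ^ ν)) {F : ℝ → ℝ → ℝ}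
    (hcomm : ∀ a b, F a b = F b a) (hmul : ∀ c a b, F (c * a) (c * b) = c * F a b) :
    ∑ o, F (effectiveChannel p i 0 o) (effectiveChannel p i 1 o) =
      2 * sourceSum F (polarSource p i) := by
  have hswap : ∀ v (c : ZMod 2), F (polarSource p i v (c - 0)) (polarSource p i v (c - 1)) =
      F (polarSource p i v 0) (polarSource p i v 1) := by
    intro v c
    fin_cases c
    · rfl
    · exact hcomm _ _
  have hfibre : ∀ x, ∑ v, F (effectiveChannel p i 0 (polarEquiv ν x, v))
      (effectiveChannel p i 1 (polarEquiv ν x, v)) =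
        (1 / 2) ^ (2 ^ ν - 1) * sourceSum F (polarSource p i) := fun x => by
    simp only [effectiveChannel_polarEquiv, hmul, hswap, ← Finset.mul_sum]
    exact congrArg _ ((Equiv.subLeft (wordPrefix i x)).sum_comp fun v =>
      F (polarSource p i v 0) (polarSource p i v 1))
  rw [Fintype.sum_prod_type, ← (polarEquiv ν).sum_comp]
  simp only [hfibre, Finset.sum_const, Finset.card_univ, Fintype.card_fun, ZMod.card,
    Fintype.card_fin, nsmul_eq_mul, ← mul_assoc]
  rw [Nat.cast_pow, Nat.cast_two, ← mul_pow_sub_one (NeZero.ne (2 ^ ν)), mul_assoc (2 : ℝ),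
    ← mul_pow]
  norm_num

theorem capacity_effectiveChannel {p : ℝ} (hp : p ∈ Set.Icc 0 1) (i : Fin (2 ^ ν)) :
    capacity (effectiveChannel p i) = 1 - condEntropy (polarSource p i) / log 2 := by
  have hnonneg : ∀ b o, 0 ≤ effectiveChannel p i b o := by
    rintro b ⟨y, v⟩
    obtain ⟨x, rfl⟩ := (polarEquiv ν).surjective y
    rw [effectiveChannel_polarEquiv]
    exact mul_nonneg (by positivity) ((isSource_polarSource hp i).nonneg _ _)
  rw [capacity_eq_sub_sum_bitEntropy hnonneg,
    sum_effectiveChannel p i bitEntropy_comm bitEntropy_mul,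
    sum_effectiveChannel p i add_comm fun c a b => (mul_add c a b).symm,
    (isSource_polarSource hp i).total, condEntropy]
  ring

end Capacity

/-! ### Error probability of the syndrome decoder -/

section Decoder

theorem sum_biUnion_le_sum_sum {ι α : Type*} [DecidableEq α] {g : α → ℝ} (hg : ∀ x, 0 ≤ g x)
    (s : Finset ι) (t : ι → Finset α) : ∑ x ∈ s.biUnion t, g x ≤ ∑ i ∈ s, ∑ x ∈ t i, g x := by
  classical
  induction s using Finset.induction_on with
  | empty => simp
  | insert i s hi ih =>
    rw [Finset.biUnion_insert, Finset.sum_insert hi]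
    have hunion := Finset.sum_union_inter (s₁ := t i) (s₂ := s.biUnion t) (f := g)
    have hinter := Finset.sum_nonneg fun x (_ : x ∈ t i ∩ s.biUnion t) => hg x
    linarith

variable {ν : ℕ}

/-- The words whose bit `i` is not strictly more likely than its complement, given the bits before
it: the only ones for which successive cancellation may go wrong at the position `i`. -/
noncomputable def ambiguousWords (p : ℝ) (i : Fin (2 ^ ν)) : Finset (Fin (2 ^ ν) → ZMod 2) :=
  {w | polarSource p i (wordPrefix i w) (w i) ≤ polarSource p i (wordPrefix i w) (w i + 1)}

theorem sum_ambiguousWords_le {p : ℝ} (hp : p ∈ Set.Icc 0 1) (i : Fin (2 ^ ν)) :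
    ∑ w ∈ ambiguousWords p i, wordMass p w ≤ 2 * condEntropy (polarSource p i) :=
  (sum_filter_jointMass_le (wordMass_nonneg hp)).trans <|
    mul_le_mul_of_nonneg_left (isSource_polarSource hp i).sourceSum_min_le_condEntropy zero_le_two

variable {p : ℝ} {A : Finset (Fin (2 ^ ν))}
  {f : ({j : Fin (2 ^ ν) // j ∉ A} → ZMod 2) → (Fin (2 ^ ν) → ZMod 2)}

-- Given the syndrome of a word, the decoder recovers its bits one by one until it meets an
-- information bit at which the word is ambiguous.
theorem IsPolarSyndromeDecoder.exists_mem_ambiguousWords (hf : IsPolarSyndromeDecoder p A f)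
    {w : Fin (2 ^ ν) → ZMod 2} (hw : polarEquiv ν w ∉ Set.range f) :
    ∃ i ∈ A, w ∈ ambiguousWords p i := by
  by_contra! hunambiguous
  simp only [ambiguousWords, Finset.mem_filter_univ, not_le] at hunambiguous
  obtain ⟨u, hfrozen, hmax, hu⟩ := hf fun j => w j.1
  have huw : ∀ j, u j = w j := by
    intro j
    induction j using WellFoundedLT.induction with
    | ind j ih =>
      by_cases hj : j ∈ A
      · have hmax' := hmax j hj (w j)
        simp only [prefixMass_eq_polarSource, wordPrefix_eq_iff.2 ih] at hmax'
        by_contra hne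
        have hflip : u j = w j + 1 := by
          revert hne
          generalize u j = a
          generalize w j = b
          revert a b
          decide
        rw [hflip] at hmax'
        exact (hunambiguous j hj).not_ge hmax'
      · exact hfrozen ⟨j, hj⟩
  exact hw ⟨_, by rw [hu, funext huw, polarEquiv_apply]⟩

theorem IsPolarSyndromeDecoder.sum_compl_image_le (hf : IsPolarSyndromeDecoder p A f)
    (hp : p ∈ Set.Icc 0 1) :
    ∑ x ∈ (Finset.univ.image f)ᶜ, ∏ j, bitMass p (x j) ≤
      ∑ i ∈ A, 2 * condEntropy (polarSource p i) := by
  calc ∑ x ∈ (Finset.univ.image f)ᶜ, ∏ j, bitMass p (x j)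
      = ∑ w with polarEquiv ν w ∉ Set.range f, wordMass p w :=
        (Finset.sum_equiv (polarEquiv ν) (by simp) fun _ _ => rfl).symm
    _ ≤ ∑ w ∈ A.biUnion (ambiguousWords p), wordMass p w := by
        refine Finset.sum_le_sum_of_subset_of_nonneg (fun w hw => ?_)
          fun w _ _ => wordMass_nonneg hp w
        exact Finset.mem_biUnion.2
          (hf.exists_mem_ambiguousWords ((Finset.mem_filter_univ w).1 hw))
    _ ≤ ∑ i ∈ A, ∑ w ∈ ambiguousWords p i, wordMass p w :=
        sum_biUnion_le_sum_sum (wordMass_nonneg hp) _ _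
    _ ≤ ∑ i ∈ A, 2 * condEntropy (polarSource p i) :=
        Finset.sum_le_sum fun i _ => sum_ambiguousWords_le hp i

end Decoder

/-! ### The source state -/

section SourceState

open Real

theorem tensorPower_mul (M M' : Matrix (ZMod 2) (ZMod 2) ℂ) (N : ℕ) :
    tensorPower M N * tensorPower M' N = tensorPower (M * M') N := by
  ext x y
  simp only [tensorPower, Matrix.mul_apply, Matrix.of_apply, Fintype.prod_sum,
    Finset.prod_mul_distrib]

theorem conjTranspose_tensorPower (M : Matrix (ZMod 2) (ZMod 2) ℂ) (N : ℕ) :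
    (tensorPower M N).conjTranspose = tensorPower M.conjTranspose N := by
  ext x y
  simp [tensorPower, Matrix.conjTranspose_apply]

theorem tensorPower_diagonalQubit_diag (p : ℝ) (N : ℕ) (x : Fin N → ZMod 2) :
    tensorPower (diagonalQubit p) N x x = ((∏ j, bitMass p (x j) : ℝ) : ℂ) := by
  simp [tensorPower, diagonalQubit]

theorem failureProbability_eq_sum {ρ U : Matrix (ZMod 2) (ZMod 2) ℂ} {p : ℝ}
    (hp : U * ρ * U.conjTranspose = diagonalQubit p) {ν : ℕ} {A : Finset (Fin (2 ^ ν))}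
    (f : ({j : Fin (2 ^ ν) // j ∉ A} → ZMod 2) → (Fin (2 ^ ν) → ZMod 2)) :
    failureProbability ρ U f =
      ((∑ x ∈ (Finset.univ.image f)ᶜ, ∏ j, bitMass p (x j) : ℝ) : ℂ) := by
  have htotal := Finset.sum_add_sum_compl (Finset.univ.image f)
    fun x : Fin (2 ^ ν) → ZMod 2 => ∏ j, bitMass p (x j)
  rw [sum_prod_bitMass] at htotal
  rw [failureProbability, conjTranspose_tensorPower, tensorPower_mul, tensorPower_mul, hp,
    correctableProjector, Finset.sum_mul, Matrix.trace_sum, eq_sub_of_add_eq' htotal]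
  simp only [Matrix.trace_single_mul, one_smul, tensorPower_diagonalQubit_diag]
  push_cast
  rfl

theorem sum_eigenvalues_eq_of_unitary_diagonal {n M : Type*} [Fintype n] [DecidableEq n]
    [AddCommMonoid M] {A U : Matrix n n ℂ} (hA : A.IsHermitian)
    (hU : U ∈ Matrix.unitaryGroup n ℂ) {d : n → ℝ}
    (hd : U * A * U.conjTranspose = Matrix.diagonal fun i => (d i : ℂ)) (g : ℝ → M) :
    ∑ i, g (hA.eigenvalues i) = ∑ i, g (d i) := by
  have hcharpoly : A.charpoly = (Matrix.diagonal fun i => (d i : ℂ)).charpoly := by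
    rw [← hd, Matrix.charpoly_mul_comm, ← Matrix.mul_assoc, ← Matrix.star_eq_conjTranspose,
      Matrix.mem_unitaryGroup_iff'.1 hU, Matrix.one_mul]
  have hroots : Finset.univ.val.map (Complex.ofReal ∘ hA.eigenvalues) =
      Finset.univ.val.map (Complex.ofReal ∘ d) := by
    refine hA.roots_charpoly_eq_eigenvalues.symm.trans ?_
    rw [hcharpoly, Matrix.charpoly_diagonal, Polynomial.roots_prod _ _
      (Finset.prod_ne_zero_iff.2 fun i _ => Polynomial.X_sub_C_ne_zero _)]
    simp only [Polynomial.roots_X_sub_C, Multiset.bind_singleton, Function.comp_def]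
  rw [← Multiset.map_map, ← Multiset.map_map] at hroots
  have hvalues := Multiset.map_injective Complex.ofReal_injective hroots
  have hsums := congrArg (fun s => (s.map g).sum) hvalues
  simp only [Multiset.map_map] at hsums
  exact hsums

theorem IsDensityMatrix.mem_Icc_of_diagonalQubit {ρ U : Matrix (ZMod 2) (ZMod 2) ℂ}
    (hρ : IsDensityMatrix ρ) {p : ℝ} (hp : U * ρ * U.conjTranspose = diagonalQubit p) :
    p ∈ Set.Icc 0 1 := by
  have hdiag : ∀ b, 0 ≤ bitMass p b := by
    have h := hρ.posSemidef.mul_mul_conjTranspose_same U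
    rw [hp, diagonalQubit, Matrix.posSemidef_diagonal_iff] at h
    exact_mod_cast h
  exact ⟨hdiag 1, sub_nonneg.1 (hdiag 0)⟩

theorem vonNeumannEntropy_eq_binEntropy {ρ U : Matrix (ZMod 2) (ZMod 2) ℂ} (hρ : ρ.IsHermitian)
    (hU : U ∈ Matrix.unitaryGroup (ZMod 2) ℂ) {p : ℝ}
    (hp : U * ρ * U.conjTranspose = diagonalQubit p) :
    vonNeumannEntropy hρ = binEntropy p / log 2 := by
  have hbit : bitMass p 0 = 1 - p ∧ bitMass p 1 = p := ⟨rfl, rfl⟩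
  rw [vonNeumannEntropy, sum_eigenvalues_eq_of_unitary_diagonal hρ hU hp fun x => x * logb 2 x,
    sum_zmod_two, hbit.1, hbit.2, binEntropy_eq_negMulLog_add_negMulLog_one_sub]
  simp only [negMulLog, logb]
  ring

end SourceState

/-! ### The compression protocol -/

section Protocol

open Filter

variable {p : ℝ} {ν : ℕ} {A : Finset (Fin (2 ^ ν))}

theorem IsPolarInformationSet.condEntropy_le_of_mem {K : ℕ} (hA : IsPolarInformationSet p ν K A)
    (hp : p ∈ Set.Icc 0 1) {t : ℝ}
    (hK : K ≤ (Finset.univ.filter fun i : Fin (2 ^ ν) => bhattacharyya (polarSource p i) ≤ t).card)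
    {i : Fin (2 ^ ν)} (hi : i ∈ A) : condEntropy (polarSource p i) ≤ 2 * t := by
  set B := Finset.univ.filter fun i : Fin (2 ^ ν) => bhattacharyya (polarSource p i) ≤ t
  have hB : ∀ j ∈ B, condEntropy (polarSource p j) ≤ 2 * t := fun j hj =>
    (isSource_polarSource hp j).condEntropy_le_two_mul_bhattacharyya.trans
      (mul_le_mul_of_nonneg_left (Finset.mem_filter.1 hj).2 zero_le_two)
  by_cases hiB : i ∈ B
  · exact hB i hiB
  obtain ⟨j, hjB, hjA⟩ : ∃ j ∈ B, j ∉ A := by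
    by_contra! hBA
    have hlt : B.card < A.card := Finset.card_lt_card ⟨hBA, fun hAB => hiB (hAB hi)⟩
    exact (hlt.trans_le (hA.1.trans_le hK)).false
  have hcap := hA.2 i hi j hjA
  rw [capacity_effectiveChannel hp, capacity_effectiveChannel hp, sub_le_sub_iff_left,
    div_le_div_iff_of_pos_right (Real.log_pos one_lt_two)] at hcap
  exact hcap.trans (hB j hjB)

theorem IsPolarSyndromeDecoder.sum_compl_image_le_mul
    {f : ({j : Fin (2 ^ ν) // j ∉ A} → ZMod 2) → (Fin (2 ^ ν) → ZMod 2)}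
    (hf : IsPolarSyndromeDecoder p A f) (hp : p ∈ Set.Icc 0 1) {t : ℝ}
    (ht : ∀ i ∈ A, condEntropy (polarSource p i) ≤ 2 * t) :
    ∑ x ∈ (Finset.univ.image f)ᶜ, ∏ j, bitMass p (x j) ≤ 4 * |2 ^ ν * t| := by
  have hcard : (A.card : ℝ) ≤ 2 ^ ν := by
    exact_mod_cast A.card_le_univ.trans_eq (Fintype.card_fin _)
  calc ∑ x ∈ (Finset.univ.image f)ᶜ, ∏ j, bitMass p (x j)
      ≤ ∑ i ∈ A, 2 * condEntropy (polarSource p i) := hf.sum_compl_image_le hp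
    _ ≤ A.card • (4 * |t|) := Finset.sum_le_card_nsmul _ _ _ fun i hi => by
        linarith [ht i hi, le_abs_self t]
    _ ≤ 2 ^ ν * (4 * |t|) := by
        rw [nsmul_eq_mul]
        gcongr
    _ = 4 * |2 ^ ν * t| := by
        rw [abs_mul, abs_of_nonneg (by positivity : (0 : ℝ) ≤ 2 ^ ν)]
        ring

theorem tendsto_sum_compl_image (hp : p ∈ Set.Icc 0 1) {δ : ℝ} (hδ : 0 < δ)
    {A : (ν : ℕ) → Finset (Fin (2 ^ ν))}
    (hA : ∀ ν, IsPolarInformationSet p ν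
      ⌊(1 - Real.binEntropy p / Real.log 2 - δ) * (2 : ℝ) ^ ν⌋₊ (A ν))
    {f : (ν : ℕ) → ({j : Fin (2 ^ ν) // j ∉ A ν} → ZMod 2) → (Fin (2 ^ ν) → ZMod 2)}
    (hf : ∀ ν, IsPolarSyndromeDecoder p (A ν) (f ν)) :
    Tendsto (fun ν => ∑ x ∈ (Finset.univ.image (f ν))ᶜ, ∏ j, bitMass p (x j)) atTop (nhds 0) := by
  obtain ⟨t, ht, hcard⟩ := (isPolarTree_polarSource hp).exists_eventually_le_card hδ
  rw [condEntropy_polarSource_root] at hcard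
  have hbound : Tendsto (fun ν => 4 * |2 ^ ν * t ν|) atTop (nhds 0) := by
    simpa using ht.abs.const_mul 4
  refine squeeze_zero' (Eventually.of_forall fun ν => ?_) (hcard.mono fun ν hν => ?_) hbound
  · exact Finset.sum_nonneg fun x _ => Finset.prod_nonneg fun j _ => bitMass_nonneg hp _
  · exact (hf ν).sum_compl_image_le_mul hp fun i hi =>
      (hA ν).condEntropy_le_of_mem hp (Nat.floor_le_of_le hν) hi

theorem card_compl_le_ceil {x : ℝ} (hA : A.card = ⌊(1 - x) * (2 : ℝ) ^ ν⌋₊) :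
    Aᶜ.card ≤ ⌈(2 : ℝ) ^ ν * x⌉₊ := by
  rw [Finset.card_compl, Fintype.card_fin, hA, Nat.sub_le_iff_le_add]
  have hfloor := Nat.lt_floor_add_one ((1 - x) * (2 : ℝ) ^ ν)
  have hceil := Nat.le_ceil ((2 : ℝ) ^ ν * x)
  have hlt : (2 : ℝ) ^ ν < ⌈(2 : ℝ) ^ ν * x⌉₊ + ⌊(1 - x) * (2 : ℝ) ^ ν⌋₊ + 1 := by linarith
  exact Nat.lt_succ_iff.1 (by exact_mod_cast hlt)

theorem tendsto_card_compl_div {x : ℝ} {A : (ν : ℕ) → Finset (Fin (2 ^ ν))}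
    (hA : ∀ ν, (A ν).card = ⌊(1 - x) * (2 : ℝ) ^ ν⌋₊) :
    Tendsto (fun ν => ((A ν)ᶜ.card : ℝ) / (2 : ℝ) ^ ν) atTop (nhds (min x 1)) := by
  have hcard : ∀ ν, ((A ν)ᶜ.card : ℝ) / (2 : ℝ) ^ ν =
      1 - (⌊(1 - x) * (2 : ℝ) ^ ν⌋₊ : ℝ) / (2 : ℝ) ^ ν := by
    intro ν
    rw [Finset.card_compl, Nat.cast_sub (A ν).card_le_univ, Fintype.card_fin, hA, sub_div,
      Nat.cast_pow, Nat.cast_two, div_self (by positivity)]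
  simp only [hcard]
  rcases le_total x 1 with hx | hx
  · have hfloor := (tendsto_nat_floor_mul_div_atTop (sub_nonneg.2 hx)).comp
      (tendsto_pow_atTop_atTop_of_one_lt (one_lt_two (α := ℝ)))
    simpa [min_eq_left hx] using hfloor.const_sub 1
  · have hzero : ∀ ν : ℕ, ⌊(1 - x) * (2 : ℝ) ^ ν⌋₊ = 0 := fun ν =>
      Nat.floor_of_nonpos (mul_nonpos_of_nonpos_of_nonneg (sub_nonpos.2 hx) (by positivity))
    simp [hzero, min_eq_right hx]

end Protocol

theorem proposition2
    (ρ : Matrix (ZMod 2) (ZMod 2) ℂ) (hρ : IsDensityMatrix ρ)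
    (U : Matrix (ZMod 2) (ZMod 2) ℂ) (hU : U ∈ Matrix.unitaryGroup (ZMod 2) ℂ)
    (p : ℝ) (hp : U * ρ * U.conjTranspose = diagonalQubit p)
    (H : ℝ) (hH : H = vonNeumannEntropy hρ.posSemidef.isHermitian)
    (δ : ℝ) (hδ : 0 < δ)
    (A : (ν : ℕ) → Finset (Fin (2 ^ ν)))
    (hA : ∀ ν, IsPolarInformationSet p ν ⌊(1 - H - δ) * (2 : ℝ) ^ ν⌋₊ (A ν))
    (f : (ν : ℕ) → ({j : Fin (2 ^ ν) // j ∉ A ν} → ZMod 2) → (Fin (2 ^ ν) → ZMod 2))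
    (hf : ∀ ν, IsPolarSyndromeDecoder p (A ν) (f ν)) :
    Filter.Tendsto (fun ν => failureProbability ρ U (f ν)) Filter.atTop (nhds 0) ∧
    (∀ ν, (A ν)ᶜ.card ≤ ⌈(2 : ℝ) ^ ν * (H + δ)⌉₊) ∧
    Filter.Tendsto (fun ν => ((A ν)ᶜ.card : ℝ) / (2 : ℝ) ^ ν) Filter.atTop
      (nhds (min (H + δ) 1)) := by
  have hcard : ∀ ν, (A ν).card = ⌊(1 - (H + δ)) * (2 : ℝ) ^ ν⌋₊ := fun ν => by
    rw [(hA ν).1, sub_sub]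
  refine ⟨?_, fun ν => card_compl_le_ceil (hcard ν), tendsto_card_compl_div hcard⟩
  rw [hH, vonNeumannEntropy_eq_binEntropy hρ.posSemidef.isHermitian hU hp] at hA
  have hsum := tendsto_sum_compl_image (hρ.mem_Icc_of_diagonalQubit hp) hδ hA hf
  simp only [failureProbability_eq_sum hp]
  exact (Complex.continuous_ofReal.tendsto' 0 0 Complex.ofReal_zero).comp hsum
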